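/- For $\tau$ in the upper half-plane $\mathbb{H}$ and $q=e^{2\pi i\tau}$, let $\eta(\tau)=q^{1/24}\prod_{j=1}^{\infty}(1-q^{j})$ (with $q^{1/24}=e^{2\pi i\tau/24}$) be the Dedekind eta function, write $\eta_\ell=\eta(\ell\tau)$ for positive integers $\ell$, and set $$v=\left(\frac{\eta_{2}\eta_{5}\eta_{20}}{\eta_{1}\eta_{4}\eta_{10}}\right)^{2}.$$ Then the functions $1+v$ and $1+5v$ on $\mathbb{H}$ are eta quotients, that is, functions of the form $\tau\mapsto\prod_{\delta\mid\ell}\eta(\delta\tau)^{r_\delta}$ with $\ell$ a positive integer and integers $r_\delta$. Explicitly, for every $\tau\in\mathbb{H}$, $$1+v=\frac{\eta_{10}^{8}}{\eta_{1}\eta_{4}\eta_{5}^{3}\eta_{20}^{3}},\qquad 1+5v=\frac{\eta_{2}^{10}\eta_{5}\eta_{20}}{\eta_{1}^{5}\eta_{4}^{5}\eta_{10}^{2}}.$$ -/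

import Mathlib

/-- `etaScaled n τ = η(nτ)`, where `η` is the Dedekind eta function. -/
noncomputable def etaScaled (n : ℕ) (τ : UpperHalfPlane) : ℂ :=
  ModularForm.eta ((n : ℂ) * (τ : ℂ))

/-- The level 20 function `v = (η₂ η₅ η₂₀ / (η₁ η₄ η₁₀))²`. -/
noncomputable def levelTwentyV (τ : UpperHalfPlane) : ℂ :=
  ((etaScaled 2 τ * etaScaled 5 τ * etaScaled 20 τ) /
    (etaScaled 1 τ * etaScaled 4 τ * etaScaled 10 τ)) ^ 2

/-- A function on the upper half-plane is an eta quotient if it is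
`τ ↦ ∏_{δ ∣ ℓ} η(δτ)^{r_δ}` for some positive integer `ℓ` and integers `r_δ`. -/
def IsEtaQuotient (f : UpperHalfPlane → ℂ) : Prop :=
  ∃ (ℓ : ℕ) (r : ℕ → ℤ), 0 < ℓ ∧
    ∀ τ : UpperHalfPlane, f τ = ∏ δ ∈ ℓ.divisors, etaScaled δ τ ^ r δ

/-! Write E_n = ∏(1 - q^(nj)). The prefactors of the etas in `v` combine to exactly q, so v =
q(E₂E₅E₂₀/(E₁E₄E₁₀))². Since E(-q) = E₂³/(E₁E₄), both identities are level 10 relations with q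
replaced by -q: `level_ten_relation₁` gives 1+v and `level_ten_relation₃` gives 1+5v. The third is a
linear combination of the first two, and those are specializations of Weierstrass's three-term
relation (`weierstrass_three_term`) for (z;p)(p/z;p).

That relation is the Plücker identity: T(X+Y)T(X-Y) is, up to a factor in X, a 2×2 determinant in X
and Y. The determinant comes from multiplying two theta series and splitting the double sum by
parity. The triple product, a limit of the q-binomial theorem, links series and products. -/

open Complex Filter Topology

/-! ### Gaussian binomials and infinite products -/

/-- The infinite `q`-Pochhammer symbol `(a; p)_∞ = ∏ (1 - a pⁿ)`. -/
noncomputable def qPochInf (a p : ℂ) : ℂ := ∏' n : ℕ, (1 - a * p ^ n)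

/-- The finite `q`-factorial `(p; p)_n`. -/
noncomputable def qFac (p : ℂ) (n : ℕ) : ℂ := ∏ j ∈ Finset.range n, (1 - p ^ (j + 1))

/-- Gaussian binomial coefficients, defined by the `q`-Pascal rule. -/
noncomputable def gaussBinom (p : ℂ) : ℕ → ℕ → ℂ
  | _, 0 => 1
  | 0, _ + 1 => 0
  | n + 1, k + 1 => gaussBinom p n k + p ^ (k + 1) * gaussBinom p n (k + 1)

theorem gaussBinom_zero_right (p : ℂ) (n : ℕ) : gaussBinom p n 0 = 1 := by
  cases n <;> rfl

theorem gaussBinom_succ_succ (p : ℂ) (n k : ℕ) :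
    gaussBinom p (n + 1) (k + 1) = gaussBinom p n k + p ^ (k + 1) * gaussBinom p n (k + 1) := rfl

theorem gaussBinom_eq_zero_of_lt (p : ℂ) : ∀ {n k : ℕ}, n < k → gaussBinom p n k = 0
  | 0, _ + 1, _ => rfl
  | n + 1, k + 1, h => by
    rw [gaussBinom_succ_succ, gaussBinom_eq_zero_of_lt p (by omega : n < k),
      gaussBinom_eq_zero_of_lt p (by omega : n < k + 1)]
    ring

theorem qFac_succ (p : ℂ) (n : ℕ) : qFac p (n + 1) = qFac p n * (1 - p ^ (n + 1)) :=
  Finset.prod_range_succ _ _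

theorem gaussBinom_mul_qFac (p : ℂ) :
    ∀ n k l : ℕ, k + l = n → gaussBinom p n k * (qFac p k * qFac p l) = qFac p n
  | n, 0, l, h => by
    obtain rfl : l = n := by omega
    simp [gaussBinom_zero_right, qFac]
  | 0, k + 1, l, h => by omega
  | n + 1, k + 1, 0, h => by
    obtain rfl : k = n := by omega
    have h1 := gaussBinom_mul_qFac p k k 0 rfl
    rw [gaussBinom_succ_succ, gaussBinom_eq_zero_of_lt p (Nat.lt_succ_self k), qFac_succ]
    linear_combination (1 - p ^ (k + 1)) * h1
  | n + 1, k + 1, l + 1, h => by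
    have h1 := gaussBinom_mul_qFac p n k (l + 1) (by omega)
    have h2 := gaussBinom_mul_qFac p n (k + 1) l (by omega)
    obtain rfl : n = k + l + 1 := by omega
    rw [gaussBinom_succ_succ, qFac_succ p (k + l + 1)]
    rw [qFac_succ p l] at h1 ⊢
    rw [qFac_succ p k] at h2 ⊢
    linear_combination (1 - p ^ (k + 1)) * h1 + p ^ (k + 1) * (1 - p ^ (l + 1)) * h2

/-- The `q`-binomial theorem. -/
theorem prod_one_add_mul_pow (p : ℂ) (n : ℕ) : ∀ w : ℂ,
    ∏ j ∈ Finset.range n, (1 + w * p ^ j) =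
      ∑ k ∈ Finset.range (n + 1), gaussBinom p n k * p ^ (k.choose 2) * w ^ k := by
  induction n with
  | zero => intro w; simp [gaussBinom_zero_right]
  | succ n ih =>
    intro w
    rw [Finset.prod_range_succ', Finset.prod_congr rfl
      (fun j _ => show 1 + w * p ^ (j + 1) = 1 + (w * p) * p ^ j by ring), ih (w * p),
      Finset.sum_range_succ' _ (n + 1)]
    have key : ∀ k, gaussBinom p (n + 1) (k + 1) * p ^ ((k + 1).choose 2) * w ^ (k + 1) =
        w * (gaussBinom p n k * p ^ (k.choose 2) * (w * p) ^ k) +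
          gaussBinom p n (k + 1) * p ^ ((k + 1).choose 2) * (w * p) ^ (k + 1) := by
      intro k
      rw [gaussBinom_succ_succ, Nat.choose_succ_succ' k 1, Nat.choose_one_right]
      ring
    rw [Finset.sum_congr rfl (fun k _ => key k), Finset.sum_add_distrib, ← Finset.mul_sum,
      Finset.sum_range_succ (fun k => gaussBinom p n (k + 1) * _ * _),
      gaussBinom_eq_zero_of_lt p (Nat.lt_succ_self n),
      Finset.sum_range_succ' (fun k => gaussBinom p n k * p ^ (k.choose 2) * (w * p) ^ k)]
    simp only [gaussBinom_zero_right, show Nat.choose 0 2 = 0 from rfl]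
    ring

theorem summable_norm_mul_pow (a : ℂ) {p : ℂ} (hp : ‖p‖ < 1) :
    Summable fun n : ℕ => ‖-(a * p ^ n)‖ := by
  simpa using (summable_geometric_of_lt_one (norm_nonneg p) hp).mul_left ‖a‖

theorem multipliable_qPochInf (a : ℂ) {p : ℂ} (hp : ‖p‖ < 1) :
    Multipliable fun n : ℕ => 1 - a * p ^ n := by
  simpa [sub_eq_add_neg] using multipliable_one_add_of_summable (summable_norm_mul_pow a hp)

theorem tendsto_prod_qPochInf (a : ℂ) {p : ℂ} (hp : ‖p‖ < 1) :
    Tendsto (fun N => ∏ n ∈ Finset.range N, (1 - a * p ^ n)) atTop (𝓝 (qPochInf a p)) :=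
  (multipliable_qPochInf a hp).tendsto_prod_tprod_nat

theorem one_sub_pow_succ_ne_zero {p : ℂ} (hp : ‖p‖ < 1) (n : ℕ) : 1 - p ^ (n + 1) ≠ 0 := by
  intro h
  have h1 : ‖p ^ (n + 1)‖ = 1 := by rw [← sub_eq_zero.mp h, norm_one]
  rw [norm_pow] at h1
  exact (pow_lt_one₀ (norm_nonneg p) hp n.succ_ne_zero).ne h1

theorem qPochInf_self_ne_zero {p : ℂ} (hp : ‖p‖ < 1) : qPochInf p p ≠ 0 := by
  have := tprod_one_add_ne_zero_of_summable (f := fun n : ℕ => -(p * p ^ n)) (fun n => by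
    have := one_sub_pow_succ_ne_zero hp n
    rwa [pow_succ', sub_eq_add_neg] at this) (summable_norm_mul_pow p hp)
  simpa [qPochInf, sub_eq_add_neg] using this

theorem qFac_ne_zero {p : ℂ} (hp : ‖p‖ < 1) (n : ℕ) : qFac p n ≠ 0 :=
  Finset.prod_ne_zero_iff.mpr fun j _ => one_sub_pow_succ_ne_zero hp j

theorem tendsto_qFac {p : ℂ} (hp : ‖p‖ < 1) : Tendsto (qFac p) atTop (𝓝 (qPochInf p p)) := by
  refine (tendsto_prod_qPochInf p hp).congr fun N => ?_
  simp only [qFac, pow_succ']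

theorem gaussBinom_eq_div {p : ℂ} (hp : ‖p‖ < 1) {n k l : ℕ} (h : k + l = n) :
    gaussBinom p n k = qFac p n * ((qFac p k)⁻¹ * (qFac p l)⁻¹) := by
  rw [← gaussBinom_mul_qFac p n k l h]
  field_simp [qFac_ne_zero hp k, qFac_ne_zero hp l]

/-- Gaussian binomial coefficients are uniformly bounded for `‖p‖ < 1`. -/
theorem exists_norm_gaussBinom_le {p : ℂ} (hp : ‖p‖ < 1) :
    ∃ M : ℝ, ∀ n k, ‖gaussBinom p n k‖ ≤ M := by
  obtain ⟨A, hA⟩ := (tendsto_qFac hp).norm.bddAbove_range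
  obtain ⟨B, hB⟩ := ((tendsto_qFac hp).inv₀ (qPochInf_self_ne_zero hp)).norm.bddAbove_range
  have hA' : ∀ n, ‖qFac p n‖ ≤ A := fun n => hA ⟨n, rfl⟩
  have hB' : ∀ n, ‖(qFac p n)⁻¹‖ ≤ B := fun n => hB ⟨n, rfl⟩
  have hA0 : 0 ≤ A := (norm_nonneg _).trans (hA' 0)
  have hB0 : 0 ≤ B := (norm_nonneg _).trans (hB' 0)
  refine ⟨A * (B * B), fun n k => ?_⟩
  rcases lt_or_ge n k with h | h
  · rw [gaussBinom_eq_zero_of_lt p h, norm_zero]; positivity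
  · rw [gaussBinom_eq_div hp (Nat.add_sub_cancel' h), norm_mul, norm_mul]
    gcongr
    exacts [hA' _, hB' _, hB' _]

/-- Splitting an infinite `q`-Pochhammer symbol along residue classes of the exponent. -/
theorem qPochInf_eq_prod (a : ℂ) {p : ℂ} (hp : ‖p‖ < 1) (k : ℕ) [NeZero k] :
    qPochInf a p = ∏ j : Fin k, qPochInf (a * p ^ (j : ℕ)) (p ^ k) := by
  have hpk : ‖p ^ k‖ < 1 := by
    rw [norm_pow]; exact pow_lt_one₀ (norm_nonneg p) hp (NeZero.ne k)
  obtain ⟨e, he⟩ : ∃ e : Fin k × ℕ ≃ ℕ, ∀ j n, e (j, n) = j + k * n :=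
    ⟨(Equiv.prodComm _ _).trans (Nat.divModEquiv k).symm, fun j n => by
      simp [mul_comm, add_comm]⟩
  have he' : ∀ (j : Fin k) (n : ℕ), 1 - a * p ^ e (j, n) =
      1 - a * p ^ (j : ℕ) * (p ^ k) ^ n := by
    intro j n
    rw [he, pow_add, pow_mul, mul_assoc]
  have hm : Multipliable fun x : Fin k × ℕ => 1 - a * p ^ e x :=
    e.multipliable_iff.mpr (multipliable_qPochInf a hp)
  unfold qPochInf
  rw [← e.tprod_eq, hm.tprod_prod', tprod_fintype]
  · exact Finset.prod_congr rfl fun j _ => tprod_congr (he' j)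
  · intro j
    simp only [he']
    exact multipliable_qPochInf _ hpk

theorem qPochInf_mul_neg (a : ℂ) {p : ℂ} (hp : ‖p‖ < 1) :
    qPochInf a p * qPochInf (-a) p = qPochInf (a ^ 2) (p ^ 2) := by
  unfold qPochInf
  rw [← (multipliable_qPochInf a hp).tprod_mul (multipliable_qPochInf (-a) hp)]
  exact tprod_congr fun n => by ring

theorem qPochInf_eq_one_sub_mul (a : ℂ) {p : ℂ} (hp : ‖p‖ < 1) :
    qPochInf a p = (1 - a) * qPochInf (a * p) p := by
  refine tendsto_nhds_unique ((tendsto_prod_qPochInf a hp).comp (tendsto_add_atTop_nat 1)) ?_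
  refine ((tendsto_prod_qPochInf (a * p) hp).const_mul (1 - a)).congr fun N => ?_
  simp only [Function.comp_apply, Finset.prod_range_succ', pow_zero, mul_one]
  rw [mul_comm]
  congr 1
  exact Finset.prod_congr rfl fun n _ => by ring

/-! ### Jacobi triple product -/

/-- With z = e^(2πiu) and p = e^(2πiτ), the shift by (1-τ)/2 turns the m-th term into (-z)^m
p^(m(m-1)/2), the form in the q-binomial theorem. -/
theorem jacobiTheta₂_term_add_one (m : ℤ) (u τ : ℂ) :
    jacobiTheta₂_term (m + 1) (u + (1 - τ) / 2) τ =
      jacobiTheta₂_term m (u + (1 - τ) / 2) τ *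
        -(cexp (2 * Real.pi * I * u) * cexp (2 * Real.pi * I * τ) ^ m) := by
  rw [jacobiTheta₂_term, jacobiTheta₂_term, ← Complex.exp_int_mul, ← Complex.exp_add,
    neg_eq_neg_one_mul, ← Complex.exp_pi_mul_I, ← Complex.exp_add, ← Complex.exp_add]
  congr 1
  push_cast
  ring

theorem jacobiTheta₂_term_neg_natCast (u τ : ℂ) (N : ℕ) :
    (∏ j ∈ Finset.range N,
      -(cexp (2 * Real.pi * I * u) / cexp (2 * Real.pi * I * τ) ^ (j + 1))) *
        jacobiTheta₂_term (-N) (u + (1 - τ) / 2) τ = 1 := by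
  induction N with
  | zero => simp [jacobiTheta₂_term]
  | succ N ih =>
    have h := jacobiTheta₂_term_add_one (-(N + 1 : ℕ)) u τ
    rw [show (-(N + 1 : ℕ) + 1 : ℤ) = -N by push_cast; ring, zpow_neg, zpow_natCast] at h
    rw [h] at ih
    rw [Finset.prod_range_succ]
    refine Eq.trans ?_ ih
    ring

/-- Taking w = -z/p^N in the q-binomial theorem centres its sum at k = N; both sides then have the
same ratio of consecutive terms. -/
theorem pow_choose_two_mul_pow_eq (u τ : ℂ) (N k : ℕ) :
    cexp (2 * Real.pi * I * τ) ^ (k.choose 2) *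
        (-(cexp (2 * Real.pi * I * u) / cexp (2 * Real.pi * I * τ) ^ N)) ^ k =
      (∏ j ∈ Finset.range N,
        -(cexp (2 * Real.pi * I * u) / cexp (2 * Real.pi * I * τ) ^ (j + 1))) *
          jacobiTheta₂_term (k - N) (u + (1 - τ) / 2) τ := by
  induction k with
  | zero =>
    rw [show ((0 : ℕ) - N : ℤ) = -N by simp, jacobiTheta₂_term_neg_natCast]
    simp
  | succ k ih =>
    rw [show ((k + 1 : ℕ) - N : ℤ) = (k - N) + 1 by push_cast; ring, jacobiTheta₂_term_add_one,
      ← mul_assoc, ← ih, zpow_sub₀ (Complex.exp_ne_zero _), zpow_natCast, zpow_natCast,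
      Nat.choose_succ_succ' k 1, Nat.choose_one_right]
    ring

/-- The finite form of the Jacobi triple product identity. -/
theorem finite_jacobi_triple_product (u τ : ℂ) (N : ℕ) :
    (∏ n ∈ Finset.range N, (1 - cexp (2 * Real.pi * I * u) * cexp (2 * Real.pi * I * τ) ^ n)) *
      (∏ n ∈ Finset.range N, (1 - cexp (2 * Real.pi * I * τ) / cexp (2 * Real.pi * I * u) *
        cexp (2 * Real.pi * I * τ) ^ n)) =
    ∑ k ∈ Finset.range (2 * N + 1), gaussBinom (cexp (2 * Real.pi * I * τ)) (2 * N) k *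
      jacobiTheta₂_term (k - N) (u + (1 - τ) / 2) τ := by
  have hexp := pow_choose_two_mul_pow_eq u τ N
  have hC : (∏ j ∈ Finset.range N,
      -(cexp (2 * Real.pi * I * u) / cexp (2 * Real.pi * I * τ) ^ (j + 1))) ≠ 0 :=
    left_ne_zero_of_mul_eq_one (jacobiTheta₂_term_neg_natCast u τ N)
  have hz : cexp (2 * Real.pi * I * u) ≠ 0 := Complex.exp_ne_zero _
  have hp : cexp (2 * Real.pi * I * τ) ≠ 0 := Complex.exp_ne_zero _
  generalize cexp (2 * Real.pi * I * u) = z at *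
  generalize cexp (2 * Real.pi * I * τ) = p at *
  apply mul_left_cancel₀ hC
  have hq := prod_one_add_mul_pow p (2 * N) (-(z / p ^ N))
  simp only [mul_assoc, hexp] at hq
  rw [Finset.mul_sum]
  simp only [mul_left_comm _ (gaussBinom p _ _)]
  -- The first N of the 2N factors, reversed, are 1 - z/p^(j+1) = -(z/p^(j+1))(1 - (p/z)p^j); the
  -- last N are 1 - zp^j.
  rw [← hq, two_mul, Finset.prod_range_add,
    ← Finset.prod_range_reflect (fun j => 1 + -(z / p ^ N) * p ^ j) N, mul_comm
    (∏ n ∈ Finset.range N, (1 - z * p ^ n)), ← mul_assoc, ← Finset.prod_mul_distrib]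
  congr 1
  · refine Finset.prod_congr rfl fun j hj => ?_
    have hj' : N = (N - 1 - j) + (j + 1) := by have := Finset.mem_range.mp hj; omega
    have : p ^ N = p ^ (N - 1 - j) * p ^ (j + 1) := by rw [← pow_add, ← hj']
    rw [this]
    field_simp
    ring
  · refine Finset.prod_congr rfl fun j _ => ?_
    rw [pow_add]
    field_simp
    ring

theorem norm_exp_two_pi_I_mul_lt_one {τ : ℂ} (hτ : 0 < τ.im) :
    ‖cexp (2 * Real.pi * I * τ)‖ < 1 :=
  UpperHalfPlane.norm_exp_two_pi_I_lt_one ⟨τ, hτ⟩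

/-- The Jacobi triple product identity. -/
theorem jacobi_triple_product (u : ℂ) {τ : ℂ} (hτ : 0 < τ.im) :
    jacobiTheta₂ (u + (1 - τ) / 2) τ =
      qPochInf (cexp (2 * Real.pi * I * τ)) (cexp (2 * Real.pi * I * τ)) *
        (qPochInf (cexp (2 * Real.pi * I * u)) (cexp (2 * Real.pi * I * τ)) *
          qPochInf (cexp (2 * Real.pi * I * τ) / cexp (2 * Real.pi * I * u))
            (cexp (2 * Real.pi * I * τ))) := by
  have hp := norm_exp_two_pi_I_mul_lt_one hτ
  have hprod := (tendsto_prod_qPochInf (cexp (2 * Real.pi * I * u)) hp).mul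
    (tendsto_prod_qPochInf (cexp (2 * Real.pi * I * τ) / cexp (2 * Real.pi * I * u)) hp)
  simp only [finite_jacobi_triple_product] at hprod
  have hsum := (summable_jacobiTheta₂_term_iff (u + (1 - τ) / 2) τ).mpr hτ
  unfold jacobiTheta₂
  generalize cexp (2 * Real.pi * I * τ) = p at *
  set t : ℤ → ℂ := fun m => jacobiTheta₂_term m (u + (1 - τ) / 2) τ with ht
  obtain ⟨M, hM⟩ := exists_norm_gaussBinom_le hp
  have hM0 : 0 ≤ M := (norm_nonneg _).trans (hM 0 0)
  -- The guard is needed because `toNat` sends negative indices to 0, where the Gaussian binomial is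
  -- 1; above 2N it vanishes by itself.
  let f : ℕ → ℤ → ℂ := fun N m =>
    if 0 ≤ N + m then gaussBinom p (2 * N) (N + m).toNat * t m else 0
  have hf : ∀ N, ∑' m, f N m =
      ∑ k ∈ Finset.range (2 * N + 1), gaussBinom p (2 * N) k * t (k - N) := by
    intro N
    rw [tsum_eq_sum (s := (Finset.range (2 * N + 1)).image fun k : ℕ => (k - N : ℤ)),
      Finset.sum_image (fun a _ b _ h => by simpa using h)]
    · refine Finset.sum_congr rfl fun k _ => ?_
      simp [f]
    · intro m hm
      simp only [f]
      split_ifs with h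
      · rw [gaussBinom_eq_zero_of_lt, zero_mul]
        by_contra hlt
        exact hm (Finset.mem_image.mpr ⟨(N + m).toNat, Finset.mem_range.mpr (by omega), by omega⟩)
      · rfl
  have hlim : Tendsto (fun N => ∑' m, f N m) atTop (𝓝 (∑' m, (qPochInf p p)⁻¹ * t m)) := by
    refine tendsto_tsum_of_dominated_convergence (bound := fun m => M * ‖t m‖)
      (hsum.norm.mul_left M) (fun m => ?_) (Eventually.of_forall fun N m => ?_)
    · have hg : Tendsto (fun N : ℕ => qFac p (2 * N) *
          ((qFac p (N + m).toNat)⁻¹ * (qFac p (N - m).toNat)⁻¹) * t m) atTop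
          (𝓝 (qPochInf p p * ((qPochInf p p)⁻¹ * (qPochInf p p)⁻¹) * t m)) := by
        have h0 := qPochInf_self_ne_zero hp
        have hT := tendsto_qFac hp
        refine (Tendsto.mul (hT.comp ?_) (((hT.comp ?_).inv₀ h0).mul
          ((hT.comp ?_).inv₀ h0))).mul_const _
        · exact tendsto_atTop_atTop.mpr fun b => ⟨b, fun N hN => by omega⟩
        · exact tendsto_atTop_atTop.mpr fun b => ⟨b + m.natAbs, fun N hN => by omega⟩
        · exact tendsto_atTop_atTop.mpr fun b => ⟨b + m.natAbs, fun N hN => by omega⟩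
      rw [mul_inv_cancel_left₀ (qPochInf_self_ne_zero hp)] at hg
      refine hg.congr' ?_
      filter_upwards [eventually_ge_atTop m.natAbs] with N hN
      simp only [f]
      rw [if_pos (by omega), gaussBinom_eq_div hp (l := (N - m).toNat) (by omega)]
    · simp only [f]
      split_ifs
      · rw [norm_mul]
        gcongr
        exact hM _ _
      · rw [norm_zero]; positivity
  simp only [hf] at hlim
  rw [tendsto_nhds_unique hprod hlim, tsum_mul_left,
    mul_inv_cancel_left₀ (qPochInf_self_ne_zero hp)]

/-! ### Theta multiplication and the three-term relation -/

theorem hasSum_int_prod_of_parity {f : ℤ × ℤ → ℂ} {a b : ℂ}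
    (ha : HasSum (fun x : ℤ × ℤ => f (x.1 + x.2, x.1 - x.2)) a)
    (hb : HasSum (fun x : ℤ × ℤ => f (x.1 + x.2 + 1, x.1 - x.2)) b) : HasSum f (a + b) := by
  have hi : Function.Injective fun x : ℤ × ℤ => (x.1 + x.2, x.1 - x.2) := by
    rintro ⟨s, t⟩ ⟨s', t'⟩ h
    simp only [Prod.mk.injEq] at h ⊢
    omega
  have hj : Function.Injective fun x : ℤ × ℤ => (x.1 + x.2 + 1, x.1 - x.2) := by
    rintro ⟨s, t⟩ ⟨s', t'⟩ h
    simp only [Prod.mk.injEq] at h ⊢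
    omega
  refine HasSum.add_isCompl ?_ (hi.hasSum_range_iff.mpr ha) (hj.hasSum_range_iff.mpr hb)
  rw [isCompl_iff, Set.disjoint_iff_inter_eq_empty, codisjoint_iff_le_sup]
  constructor
  · ext ⟨m, n⟩
    simp only [Set.mem_inter_iff, Set.mem_range, Prod.mk.injEq, Prod.exists,
      Set.mem_empty_iff_false, iff_false, not_and, not_exists]
    rintro ⟨s, t, h1, h2⟩ s' t' h3
    omega
  · rintro ⟨m, n⟩ -
    rcases Int.emod_two_eq_zero_or_one (m + n) with h | h
    · exact Or.inl ⟨((m + n) / 2, (m - n) / 2), by ext <;> simp <;> omega⟩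
    · exact Or.inr ⟨((m + n) / 2, (m - n) / 2), by ext <;> simp <;> omega⟩

/-- The product of two theta functions in terms of theta functions of twice the period. -/
theorem jacobiTheta₂_mul_jacobiTheta₂ (a b : ℂ) {τ : ℂ} (hτ : 0 < τ.im) :
    jacobiTheta₂ a τ * jacobiTheta₂ b τ =
      jacobiTheta₂ (a + b) (2 * τ) * jacobiTheta₂ (a - b) (2 * τ) +
        cexp (2 * Real.pi * I * a + Real.pi * I * τ) *
          (jacobiTheta₂ (a + b + τ) (2 * τ) * jacobiTheta₂ (a - b + τ) (2 * τ)) := by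
  have hτ2 : 0 < (2 * τ).im := by simpa using hτ
  have hs : ∀ z, Summable fun n => ‖jacobiTheta₂_term n z τ‖ := fun z =>
    ((summable_jacobiTheta₂_term_iff z τ).mpr hτ).norm
  have hs2 : ∀ z, Summable fun n => ‖jacobiTheta₂_term n z (2 * τ)‖ := fun z =>
    ((summable_jacobiTheta₂_term_iff z _).mpr hτ2).norm
  have hprod : ∀ z w, HasSum (fun x : ℤ × ℤ => jacobiTheta₂_term x.1 z (2 * τ) *
      jacobiTheta₂_term x.2 w (2 * τ)) (jacobiTheta₂ z (2 * τ) * jacobiTheta₂ w (2 * τ)) := by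
    intro z w
    rw [jacobiTheta₂, jacobiTheta₂, tsum_mul_tsum_of_summable_norm (hs2 z) (hs2 w)]
    exact (summable_mul_of_summable_norm (hs2 z) (hs2 w)).hasSum
  rw [jacobiTheta₂, jacobiTheta₂, tsum_mul_tsum_of_summable_norm (hs a) (hs b)]
  refine (hasSum_int_prod_of_parity ?_ ?_).tsum_eq
  · refine (hprod (a + b) (a - b)).congr_fun ?_
    intro x
    simp only [jacobiTheta₂_term, ← Complex.exp_add]
    congr 1
    push_cast
    ring
  · refine ((hprod (a + b + τ) (a - b + τ)).mul_left _).congr_fun ?_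
    intro x
    simp only [jacobiTheta₂_term, ← Complex.exp_add]
    congr 1
    push_cast
    ring

/-- The theta product `(z; p)_∞ (p / z; p)_∞`. -/
noncomputable def thetaProd (p z : ℂ) : ℂ := qPochInf z p * qPochInf (p / z) p

theorem thetaProd_div (p z : ℂ) (hp : p ≠ 0) : thetaProd p (p / z) = thetaProd p z := by
  rw [thetaProd, thetaProd, div_div_cancel₀ hp, mul_comm]

theorem mul_thetaProd_inv {p : ℂ} (hp : ‖p‖ < 1) {z : ℂ} (hz : z ≠ 0) :
    z * thetaProd p z⁻¹ = -thetaProd p z := by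
  rw [thetaProd, thetaProd, qPochInf_eq_one_sub_mul z hp, qPochInf_eq_one_sub_mul z⁻¹ hp,
    div_inv_eq_mul, mul_comm p z, inv_mul_eq_div]
  field_simp
  ring

/-- Products `T(X + Y) T(X - Y)` of shifted theta functions form an alternating rank-two form,
up to a factor. -/
theorem exists_thetaProd_add_mul_sub {τ : ℂ} (hτ : 0 < τ.im) :
    ∃ A B : ℂ → ℂ, ∀ X Y : ℂ,
      thetaProd (cexp (2 * Real.pi * I * τ)) (cexp (2 * Real.pi * I * (X + Y))) *
        thetaProd (cexp (2 * Real.pi * I * τ)) (cexp (2 * Real.pi * I * (X - Y))) =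
      cexp (2 * Real.pi * I * X) * (A X * B Y - B X * A Y) := by
  set P := qPochInf (cexp (2 * Real.pi * I * τ)) (cexp (2 * Real.pi * I * τ)) with hP
  have hP0 : P ≠ 0 := qPochInf_self_ne_zero (norm_exp_two_pi_I_mul_lt_one hτ)
  refine ⟨fun X => P⁻¹ * (cexp (2 * Real.pi * I * X) * jacobiTheta₂ (2 * X + τ) (2 * τ)),
    fun X => P⁻¹ * jacobiTheta₂ (2 * X) (2 * τ), fun X Y => ?_⟩
  have h := jacobiTheta₂_mul_jacobiTheta₂ (X + Y + (1 - τ) / 2) (X - Y + (1 - τ) / 2) hτ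
  rw [jacobi_triple_product _ hτ, jacobi_triple_product _ hτ, ← hP] at h
  have e1 : jacobiTheta₂ (2 * X + τ) (2 * τ) =
      cexp (-Real.pi * I * (4 * X)) * jacobiTheta₂ (2 * X - τ) (2 * τ) := by
    have := jacobiTheta₂_add_left' (2 * X - τ) (2 * τ)
    rw [show 2 * X - τ + 2 * τ = 2 * X + τ by ring] at this
    rw [this]
    ring_nf
  rw [show X + Y + (1 - τ) / 2 + (X - Y + (1 - τ) / 2) = 2 * X - τ + 1 by ring,
    show X + Y + (1 - τ) / 2 - (X - Y + (1 - τ) / 2) = 2 * Y by ring,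
    show 2 * X - τ + 1 + τ = 2 * X + 1 by ring, jacobiTheta₂_add_left, jacobiTheta₂_add_left] at h
  simp only [thetaProd, e1]
  have e2 : cexp (2 * Real.pi * I * X) * (cexp (2 * Real.pi * I * X) *
      cexp (-Real.pi * I * (4 * X))) = 1 := by
    rw [← Complex.exp_add, ← Complex.exp_add, ← Complex.exp_zero]
    congr 1
    ring
  have e3 : cexp (2 * Real.pi * I * (X + Y + (1 - τ) / 2) + Real.pi * I * τ) =
      -(cexp (2 * Real.pi * I * X) * cexp (2 * Real.pi * I * Y)) := by
    rw [neg_eq_neg_one_mul, ← Complex.exp_pi_mul_I, ← Complex.exp_add, ← Complex.exp_add]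
    congr 1
    ring
  rw [e3] at h
  apply mul_left_cancel₀ (mul_ne_zero hP0 hP0)
  refine Eq.trans (by ring) (h.trans ?_)
  generalize cexp (-Real.pi * I * (4 * X)) = E at e2 ⊢
  generalize cexp (2 * Real.pi * I * X) = F at e2 ⊢
  field_simp
  linear_combination (-jacobiTheta₂ (2 * X - τ) (2 * τ) * jacobiTheta₂ (2 * Y) (2 * τ)) * e2

/-- Weierstrass's three-term relation for theta products. -/
theorem weierstrass_three_term {p x y u v : ℂ} (hp0 : p ≠ 0) (hp : ‖p‖ < 1) (hx : x ≠ 0)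
    (hy : y ≠ 0) (hu : u ≠ 0) (hv : v ≠ 0) :
    y * (thetaProd p (x * y) * thetaProd p (x / y)) *
        (thetaProd p (u * v) * thetaProd p (u / v)) -
      u * (thetaProd p (x * u) * thetaProd p (x / u)) *
        (thetaProd p (y * v) * thetaProd p (y / v)) +
      u * (thetaProd p (x * v) * thetaProd p (x / v)) *
        (thetaProd p (y * u) * thetaProd p (y / u)) = 0 := by
  have key : ∀ z : ℂ, z ≠ 0 → ∃ w, cexp (2 * Real.pi * I * w) = z := fun z hz =>
    ⟨log z / (2 * Real.pi * I), by
      rw [mul_div_cancel₀ _ Complex.two_pi_I_ne_zero, Complex.exp_log hz]⟩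
  obtain ⟨τ, rfl⟩ := key p hp0
  obtain ⟨X, rfl⟩ := key x hx
  obtain ⟨Y, rfl⟩ := key y hy
  obtain ⟨U, rfl⟩ := key u hu
  obtain ⟨V, rfl⟩ := key v hv
  have hτ : 0 < τ.im := by
    rw [Complex.norm_exp, Real.exp_lt_one_iff] at hp
    have : (2 * Real.pi * I * τ).re = -(2 * Real.pi * τ.im) := by simp
    rw [this] at hp
    have := Real.pi_pos
    nlinarith
  obtain ⟨A, B, h⟩ := exists_thetaProd_add_mul_sub hτ
  -- All three terms acquire the same factor xyu, leaving the Plücker relation for 2×2 determinants.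
  simp only [← Complex.exp_add, ← Complex.exp_sub, ← mul_add, ← mul_sub, h]
  ring

/-! ### Euler products at level ten -/

theorem norm_pow_lt_one {q : ℂ} (hq : ‖q‖ < 1) {n : ℕ} (hn : n ≠ 0) : ‖q ^ n‖ < 1 := by
  rw [norm_pow]; exact pow_lt_one₀ (norm_nonneg q) hq hn

/-- The Euler product `∏ (1 - qⁿ)`, `n ≥ 1`. -/
noncomputable def eulerProd (q : ℂ) : ℂ := qPochInf q q

theorem eulerProd_ne_zero {q : ℂ} (hq : ‖q‖ < 1) : eulerProd q ≠ 0 := qPochInf_self_ne_zero hq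

/-- Split each product by parity of the exponent and use (q;q²)(-q;q²) = (q²;q⁴). -/
theorem eulerProd_neg {q : ℂ} (hq : ‖q‖ < 1) :
    eulerProd (-q) * (eulerProd q * eulerProd (q ^ 4)) = eulerProd (q ^ 2) ^ 3 := by
  have h2 := norm_pow_lt_one hq two_ne_zero
  have a := qPochInf_eq_prod q hq 2
  have b := qPochInf_eq_prod (-q) (p := -q) (by rwa [norm_neg]) 2
  have c := qPochInf_eq_prod (q ^ 2) h2 2
  have d := qPochInf_mul_neg q h2
  simp only [Fin.prod_univ_two, Fin.val_zero, Fin.val_one, pow_zero, mul_one, pow_one, neg_sq,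
    ← sq, ← pow_mul, Nat.reduceMul] at a b c d
  unfold eulerProd
  rw [show q ^ 2 ^ 2 = q ^ 4 by norm_num] at c d
  rw [a, b, c, ← d]
  ring

/-- A level ten relation, an instance of the three-term relation for the nome `q ^ 10`. -/
theorem level_ten_relation₁ {q : ℂ} (hq0 : q ≠ 0) (hq : ‖q‖ < 1) :
    eulerProd (q ^ 2) ^ 4 * eulerProd (q ^ 5) ^ 2 * eulerProd (q ^ 10) -
        q * eulerProd q ^ 2 * eulerProd (q ^ 10) ^ 5 =
      eulerProd q * eulerProd (q ^ 2) * eulerProd (q ^ 5) ^ 5 := by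
  have h2 := norm_pow_lt_one hq two_ne_zero
  have h5 := norm_pow_lt_one hq (n := 5) (by norm_num)
  have h10 := norm_pow_lt_one hq (n := 10) (by norm_num)
  have W := weierstrass_three_term (p := q ^ 10) (x := q ^ 3) (y := q) (u := q ^ 4) (v := q ^ 2)
    (pow_ne_zero _ hq0) h10 (pow_ne_zero _ hq0) hq0 (pow_ne_zero _ hq0) (pow_ne_zero _ hq0)
  have t := mul_thetaProd_inv h10 hq0
  have t3 := mul_thetaProd_inv h10 (pow_ne_zero 3 hq0)
  have s4 : thetaProd (q ^ 10) (q ^ 6) = thetaProd (q ^ 10) (q ^ 4) := by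
    rw [← thetaProd_div _ _ (pow_ne_zero _ hq0)]; congr 1; field_simp
  have s3 : thetaProd (q ^ 10) (q ^ 7) = thetaProd (q ^ 10) (q ^ 3) := by
    rw [← thetaProd_div _ _ (pow_ne_zero _ hq0)]; congr 1; field_simp
  rw [show q ^ 3 * q = q ^ 4 by ring, show q ^ 3 / q = q ^ 2 by field_simp,
    show q ^ 4 * q ^ 2 = q ^ 6 by ring, show q ^ 4 / q ^ 2 = q ^ 2 by field_simp,
    show q ^ 3 * q ^ 4 = q ^ 7 by ring, show q ^ 3 / q ^ 4 = q⁻¹ by field_simp,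
    show q * q ^ 2 = q ^ 3 by ring, show q / q ^ 2 = q⁻¹ by field_simp,
    show q ^ 3 * q ^ 2 = q ^ 5 by ring, show q ^ 3 / q ^ 2 = q by field_simp,
    show q * q ^ 4 = q ^ 5 by ring, show q / q ^ 4 = (q ^ 3)⁻¹ by field_simp, s3, s4] at W
  have W' : thetaProd (q ^ 10) (q ^ 4) ^ 2 * thetaProd (q ^ 10) (q ^ 2) ^ 2 -
      q * thetaProd (q ^ 10) (q ^ 3) ^ 2 * thetaProd (q ^ 10) q ^ 2 =
      thetaProd (q ^ 10) (q ^ 5) ^ 2 * thetaProd (q ^ 10) q * thetaProd (q ^ 10) (q ^ 3) := by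
    apply mul_left_cancel₀ hq0
    generalize thetaProd (q ^ 10) q⁻¹ = ti at *
    generalize thetaProd (q ^ 10) (q ^ 3)⁻¹ = t3i at *
    linear_combination W + q ^ 2 * thetaProd (q ^ 10) (q ^ 3) ^ 2 *
      (q * ti - thetaProd (q ^ 10) q) * t - q * thetaProd (q ^ 10) (q ^ 5) ^ 2 *
        thetaProd (q ^ 10) q * t3
  have e1 := qPochInf_eq_prod q hq 10
  have e2 := qPochInf_eq_prod (q ^ 2) h2 5
  have e5 := qPochInf_eq_prod (q ^ 5) h5 2
  simp only [Fin.prod_univ_succ, Fin.prod_univ_zero, Fin.val_succ, Fin.val_zero] at e1 e2 e5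
  simp only [thetaProd] at W'
  unfold eulerProd
  rw [e1, e2, e5]
  rw [show q ^ 10 / q ^ 4 = q ^ 6 by field_simp, show q ^ 10 / q ^ 2 = q ^ 8 by field_simp,
    show q ^ 10 / q ^ 3 = q ^ 7 by field_simp, show q ^ 10 / q ^ 5 = q ^ 5 by field_simp,
    show q ^ 10 / q = q ^ 9 by field_simp] at W'
  simp only [zero_add, Nat.reduceAdd, ← pow_mul, Nat.reduceMul, pow_zero, mul_one, ← pow_add,
    ← pow_succ']
  linear_combination (qPochInf (q ^ 2) (q ^ 10) * qPochInf (q ^ 4) (q ^ 10) *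
    qPochInf (q ^ 6) (q ^ 10) * qPochInf (q ^ 8) (q ^ 10) * qPochInf (q ^ 10) (q ^ 10)) ^ 2 *
    qPochInf (q ^ 5) (q ^ 10) ^ 2 * qPochInf (q ^ 10) (q ^ 10) ^ 5 * W'

/-- A level ten relation, an instance of the three-term relation for the nome `q ^ 5`. -/
theorem level_ten_relation₂ {q : ℂ} (hq0 : q ≠ 0) (hq : ‖q‖ < 1) :
    eulerProd (q ^ 5) ^ 5 * eulerProd (q ^ 2) ^ 2 -
        eulerProd q ^ 4 * eulerProd (q ^ 5) * eulerProd (q ^ 10) ^ 2 =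
      4 * q * eulerProd (q ^ 10) ^ 5 * eulerProd q * eulerProd (q ^ 2) := by
  have h2 := norm_pow_lt_one hq two_ne_zero
  have h5 := norm_pow_lt_one hq (n := 5) (by norm_num)
  have W := weierstrass_three_term (p := q ^ 5) (x := -q ^ 2) (y := q) (u := q ^ 3) (v := -q)
    (pow_ne_zero _ hq0) h5 (neg_ne_zero.mpr (pow_ne_zero _ hq0)) hq0 (pow_ne_zero _ hq0)
    (neg_ne_zero.mpr hq0)
  have t := mul_thetaProd_inv h5 (neg_ne_zero.mpr hq0)
  have t2 := mul_thetaProd_inv h5 (pow_ne_zero 2 hq0)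
  rw [show -q ^ 2 * q = -q ^ 3 by ring, show -q ^ 2 / q = -q by field_simp,
    show q ^ 3 * -q = -q ^ 4 by ring, show q ^ 3 / -q = -q ^ 2 by field_simp,
    show -q ^ 2 * q ^ 3 = -q ^ 5 by ring, show -q ^ 2 / q ^ 3 = (-q)⁻¹ by field_simp,
    show q * -q = -q ^ 2 by ring, show q / -q = -1 by field_simp,
    show -q ^ 2 * -q = q ^ 3 by ring, show -q ^ 2 / -q = q by field_simp,
    show q * q ^ 3 = q ^ 4 by ring, show q / q ^ 3 = (q ^ 2)⁻¹ by field_simp] at W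
  -- The coefficient 4 arises here: (-1;q⁵) = 2(-q⁵;q⁵) occurs twice.
  have c0 := qPochInf_eq_one_sub_mul (-1) h5
  rw [neg_one_mul] at c0
  have W' : q * (thetaProd (q ^ 5) (-q ^ 3) * thetaProd (q ^ 5) (-q) *
      (thetaProd (q ^ 5) (-q ^ 4) * thetaProd (q ^ 5) (-q ^ 2))) -
      q ^ 2 * (thetaProd (q ^ 5) (-q ^ 5) * thetaProd (q ^ 5) (-q) *
        (thetaProd (q ^ 5) (-q ^ 2) * thetaProd (q ^ 5) (-1))) =
      q * (thetaProd (q ^ 5) (q ^ 3) * thetaProd (q ^ 5) q *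
        (thetaProd (q ^ 5) (q ^ 4) * thetaProd (q ^ 5) (q ^ 2))) := by
    generalize thetaProd (q ^ 5) (-q)⁻¹ = ti at *
    generalize thetaProd (q ^ 5) (q ^ 2)⁻¹ = t2i at *
    linear_combination W - q ^ 2 * thetaProd (q ^ 5) (-q ^ 5) * thetaProd (q ^ 5) (-q ^ 2) *
      thetaProd (q ^ 5) (-1) * t - q * thetaProd (q ^ 5) (q ^ 3) * thetaProd (q ^ 5) q *
      thetaProd (q ^ 5) (q ^ 4) * t2
  have e1 := qPochInf_eq_prod q hq 5
  have e1n := qPochInf_eq_prod (-q) hq 5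
  have e2 := qPochInf_mul_neg q hq
  have e10 := qPochInf_mul_neg (q ^ 5) h5
  simp only [Fin.prod_univ_succ, Fin.prod_univ_zero, Fin.val_succ, Fin.val_zero, zero_add,
    Nat.reduceAdd, ← pow_mul, Nat.reduceMul, mul_one, neg_mul, ← pow_succ'] at e1 e1n e10
  rw [pow_one] at e1 e1n
  simp only [thetaProd] at W'
  rw [show q ^ 5 / -q ^ 3 = -q ^ 2 by field_simp, show q ^ 5 / -q ^ 4 = -q by field_simp,
    show q ^ 5 / -q ^ 2 = -q ^ 3 by field_simp, show q ^ 5 / -q = -q ^ 4 by field_simp,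
    show q ^ 5 / q ^ 3 = q ^ 2 by field_simp, show q ^ 5 / q ^ 4 = q by field_simp,
    show q ^ 5 / q ^ 2 = q ^ 3 by field_simp, show q ^ 5 / q = q ^ 4 by field_simp,
    show q ^ 5 / -q ^ 5 = -1 by field_simp, show q ^ 5 / -1 = -q ^ 5 by field_simp, c0] at W'
  unfold eulerProd
  rw [← e2, ← e10, e1, e1n]
  apply mul_left_cancel₀ hq0
  linear_combination (qPochInf q (q ^ 5) * qPochInf (q ^ 2) (q ^ 5) *
    qPochInf (q ^ 3) (q ^ 5) * qPochInf (q ^ 4) (q ^ 5)) ^ 2 *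
    qPochInf (q ^ 5) (q ^ 5) ^ 7 * qPochInf (-q ^ 5) (q ^ 5) ^ 2 * W'

theorem level_ten_relation₃ {q : ℂ} (hq0 : q ≠ 0) (hq : ‖q‖ < 1) :
    eulerProd (q ^ 2) ^ 5 * eulerProd (q ^ 5) ^ 2 -
        5 * q * eulerProd q ^ 2 * eulerProd (q ^ 2) * eulerProd (q ^ 10) ^ 4 =
      eulerProd q ^ 5 * eulerProd (q ^ 5) * eulerProd (q ^ 10) := by
  apply mul_left_cancel₀ (eulerProd_ne_zero (norm_pow_lt_one hq (n := 10) (by norm_num)))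
  linear_combination eulerProd (q ^ 2) * level_ten_relation₁ hq0 hq +
    eulerProd q * level_ten_relation₂ hq0 hq

/-! ### Passage to eta quotients -/

/-- Using r = e^(2πiτ/24) as variable, with q = r^24, makes every fractional power of q an integer
power of r. -/
theorem etaScaled_eq (n : ℕ) (τ : UpperHalfPlane) :
    etaScaled n τ = cexp (2 * Real.pi * I * τ / 24) ^ n *
      eulerProd ((cexp (2 * Real.pi * I * τ / 24) ^ 24) ^ n) := by
  rw [etaScaled, ModularForm.eta, eulerProd, qPochInf, Function.Periodic.qParam]
  congr 1
  · rw [← Complex.exp_nat_mul]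
    congr 1
    push_cast
    ring
  · refine tprod_congr fun k => ?_
    rw [ModularForm.eta_q_eq_pow, ← pow_succ', ← pow_mul, ← pow_mul, ← Complex.exp_nat_mul,
      ← Complex.exp_nat_mul]
    congr 2
    push_cast
    ring

theorem one_add_levelTwentyV (τ : UpperHalfPlane) :
    1 + levelTwentyV τ = etaScaled 10 τ ^ 8 /
      (etaScaled 1 τ * etaScaled 4 τ * etaScaled 5 τ ^ 3 * etaScaled 20 τ ^ 3) ∧
    1 + 5 * levelTwentyV τ = (etaScaled 2 τ ^ 10 * etaScaled 5 τ * etaScaled 20 τ) /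
      (etaScaled 1 τ ^ 5 * etaScaled 4 τ ^ 5 * etaScaled 10 τ ^ 2) := by
  have hr0 : cexp (2 * Real.pi * I * τ / 24) ≠ 0 := Complex.exp_ne_zero _
  have hr : ‖cexp (2 * Real.pi * I * τ / 24) ^ 24‖ < 1 := by
    rw [← Complex.exp_nat_mul]
    convert norm_exp_two_pi_I_mul_lt_one τ.im_pos using 3
    push_cast
    ring
  simp only [levelTwentyV, etaScaled_eq]
  generalize cexp (2 * Real.pi * I * τ / 24) = r at *
  obtain ⟨q, hq⟩ : ∃ q, q = r ^ 24 := ⟨_, rfl⟩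
  have hq0 : q ≠ 0 := hq ▸ pow_ne_zero _ hr0
  rw [← hq] at hr ⊢
  have hn0 : -q ≠ 0 := neg_ne_zero.mpr hq0
  have hn : ‖-q‖ < 1 := by rwa [norm_neg]
  have R1 := level_ten_relation₁ hn0 hn
  have R3 := level_ten_relation₃ hn0 hn
  have N1 := eulerProd_neg hr
  have N5 := eulerProd_neg (norm_pow_lt_one hr (n := 5) (by norm_num))
  rw [Even.neg_pow (by decide : Even 2), Even.neg_pow (by decide : Even 10),
    Odd.neg_pow (by decide : Odd 5)] at R1 R3
  simp only [← pow_mul, Nat.reduceMul] at N5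
  have E1 := eulerProd_ne_zero hr
  have E2 := eulerProd_ne_zero (norm_pow_lt_one hr (n := 2) (by norm_num))
  have E4 := eulerProd_ne_zero (norm_pow_lt_one hr (n := 4) (by norm_num))
  have E5 := eulerProd_ne_zero (norm_pow_lt_one hr (n := 5) (by norm_num))
  have E10 := eulerProd_ne_zero (norm_pow_lt_one hr (n := 10) (by norm_num))
  have E20 := eulerProd_ne_zero (norm_pow_lt_one hr (n := 20) (by norm_num))
  rw [pow_one q]
  generalize eulerProd (-q) = X at *
  generalize eulerProd (-q ^ 5) = Y at *
  generalize eulerProd q = a at *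
  generalize eulerProd (q ^ 2) = b at *
  generalize eulerProd (q ^ 4) = c at *
  generalize eulerProd (q ^ 5) = d at *
  generalize eulerProd (q ^ 10) = e at *
  generalize eulerProd (q ^ 20) = f at *
  obtain rfl : X = b ^ 3 / (a * c) := by rw [← N1]; field_simp
  obtain rfl : Y = e ^ 3 / (d * f) := by rw [← N5]; field_simp
  subst hq
  field_simp at R1 R3
  constructor
  · field_simp
    linear_combination R1
  · field_simp
    linear_combination R3

theorem mainTheorem9 :
    IsEtaQuotient (fun τ => 1 + levelTwentyV τ) ∧
    IsEtaQuotient (fun τ => 1 + 5 * levelTwentyV τ) ∧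
    ∀ τ : UpperHalfPlane,
      1 + levelTwentyV τ =
        etaScaled 10 τ ^ 8 /
          (etaScaled 1 τ * etaScaled 4 τ * etaScaled 5 τ ^ 3 * etaScaled 20 τ ^ 3) ∧
      1 + 5 * levelTwentyV τ =
        (etaScaled 2 τ ^ 10 * etaScaled 5 τ * etaScaled 20 τ) /
          (etaScaled 1 τ ^ 5 * etaScaled 4 τ ^ 5 * etaScaled 10 τ ^ 2) := by
  have hdiv : Nat.divisors 20 = {1, 2, 4, 5, 10, 20} := by decide
  -- Among the divisors of 20, the default exponent 0 is reached only at δ = 2, and the default -2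
  -- of the second quotient only at δ = 10.
  refine ⟨⟨20, fun δ => if δ = 10 then 8 else if δ = 1 then -1 else if δ = 4 then -1 else
      if δ = 5 then -3 else if δ = 20 then -3 else 0, by norm_num, fun τ => ?_⟩,
    ⟨20, fun δ => if δ = 2 then 10 else if δ = 5 then 1 else if δ = 20 then 1 else
      if δ = 1 then -5 else if δ = 4 then -5 else -2, by norm_num, fun τ => ?_⟩,
    one_add_levelTwentyV⟩
  · beta_reduce
    rw [(one_add_levelTwentyV τ).1, hdiv]
    simp [zpow_neg]
    field_simp
  · beta_reduce
    rw [(one_add_levelTwentyV τ).2, hdiv]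
    simp [zpow_neg]
    field_simp
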